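/- Let $\mathcal H$ be a complex Hilbert space of dimension at least $3$ (possibly infinite), and let $T$ be a nonzero bounded linear operator on $\mathcal H$ such that $T+T^*$ is positive semidefinite. Let $w(T)=\sup\{|\langle Ty,y\rangle| : y\in\mathcal H,\ \|y\|=1\}$ denote the numerical radius. Suppose that $T$ attains its norm at a unit vector $x\in\mathcal H$, i.e. $\|Tx\|=\|T\|$, and put $\tilde T=T/\|T\|$. Then $\|T\|/w(T)=\sqrt2$ if and only if both of the following conditions hold: 1. the compression $P_V\tilde T|_V$ of $\tilde T$ onto $V=\operatorname{span}\{x,Tx\}$, where $P_V$ is the orthogonal projection of $\mathcal H$ onto $V$, is unitarily similar to the matrix $\begin{pmatrix}2/3&1/\sqrt3\\-1/\sqrt3&0\end{pmatrix}$ acting on $\mathbb C^2$ (i.e. it has this matrix with respect to some orthonormal basis of $V$; in particular $\dim V=2$); 2. $w(\tilde T)\le 1/\sqrt2$. -/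

import Mathlib

noncomputable section

variable {E F : Type*} [NormedAddCommGroup E] [InnerProductSpace ℂ E]
  [NormedAddCommGroup F] [InnerProductSpace ℂ F]

/-- The numerical range `W(T) = {⟨T x, x⟩ : ‖x‖ = 1}` of a bounded operator. The inner product of
Mathlib is linear in its second argument, so `⟨T x, x⟩` is `inner ℂ x (T x)`. -/
def numericalRange (T : E →L[ℂ] E) : Set ℂ :=
  {μ : ℂ | ∃ x : E, ‖x‖ = 1 ∧ inner ℂ x (T x) = μ}

/-- The numerical radius `w(T) = sup {|μ| : μ ∈ W(T)}`. -/
def numericalRadius (T : E →L[ℂ] E) : ℝ :=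
  sSup ((fun μ : ℂ => ‖μ‖) '' numericalRange T)

/-- The set whose supremum is the numerical radius is bounded above by `‖T‖`. -/
theorem bddAbove_norm_numericalRange (T : E →L[ℂ] E) :
    BddAbove ((fun μ : ℂ => ‖μ‖) '' numericalRange T) := by
  refine ⟨‖T‖, ?_⟩
  rintro _ ⟨_, ⟨x, hx, rfl⟩, rfl⟩
  calc ‖inner ℂ x (T x)‖ ≤ ‖x‖ * ‖T x‖ := norm_inner_le_norm _ _
    _ ≤ ‖x‖ * (‖T‖ * ‖x‖) := by gcongr; exact T.le_opNorm x
    _ = ‖T‖ := by rw [hx]; ring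

/-- The compression `P_V T |_V : V → V` of a bounded operator `T` onto a subspace `V`. -/
def compression (T : E →L[ℂ] E) (V : Submodule ℂ E) [V.HasOrthogonalProjection] : V →L[ℂ] V :=
  V.orthogonalProjectionOnto ∘L T ∘L V.subtypeL

/-- The span of two vectors is finite dimensional, so that it has an orthogonal projection. -/
instance finiteDimensional_span_pair (x y : E) :
    FiniteDimensional ℂ (Submodule.span ℂ ({x, y} : Set E)) :=
  FiniteDimensional.span_of_finite ℂ (Set.toFinite _)

/-- Two bounded operators `A` on `E` and `B` on `F` are unitarily similar: `U A U⁻¹ = B` for some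
unitary `U : E → F`. -/
def UnitarilySimilar (A : E →L[ℂ] E) (B : F →L[ℂ] F) : Prop :=
  ∃ U : E ≃ₗᵢ[ℂ] F, ∀ v : E, U (A v) = B (U v)

/-- A bounded operator is unitarily similar to the matrix `M`, where `M` acts on `ℂⁿ` with its
Euclidean inner product. -/
def UnitarilySimilarToMatrix {n : ℕ} (A : E →L[ℂ] E) (M : Matrix (Fin n) (Fin n) ℂ) : Prop :=
  UnitarilySimilar A (Matrix.toEuclideanCLM (𝕜 := ℂ) M)

/-- The real `2 × 2` matrix `[[2/3, 1/√3], [-1/√3, 0]]`, with complex entries. -/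
def extremalMatrix : Matrix (Fin 2) (Fin 2) ℂ :=
  !![2 / 3, 1 / ((√3 : ℝ) : ℂ); -1 / ((√3 : ℝ) : ℂ), 0]

/-- The normalized operator `T / ‖T‖`. -/
def normalizedOperator (T : E →L[ℂ] E) : E →L[ℂ] E :=
  ((‖T‖ : ℂ)⁻¹) • T

end

open scoped ComplexConjugate

/-! Write `S = T / ‖T‖` and `y = S x`; the ratio is `√2` exactly when `w(S) = 1 / √2`. In that case
`W(S)` lies in a half disc, hence in the triangle with vertices `1`, `i`, `-i`, whose sides give
three positive semidefinite forms. Suitable combinations of `x` and `y` are null vectors of these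
forms, and the resulting kernel equations, with the radius bound at `x ± i y`, fix the Gram data
(`inner_eq_of_accretive`) and so the compression. Conversely, the matrix already has a numerical
value of modulus `1 / √2`. -/

/-- A null vector of the real part of an accretive form lies in the kernel of that real part. -/
theorem inner_add_inner_eq_zero_of_re_inner_eq_zero {E : Type*} [NormedAddCommGroup E]
    [InnerProductSpace ℂ E] (B : E →L[ℂ] E) (hB : ∀ v, 0 ≤ (inner ℂ v (B v)).re)
    {z : E} (hz : (inner ℂ z (B z)).re = 0) (u : E) :
    inner ℂ u (B z) + inner ℂ (B u) z = 0 := by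
  have key : ∀ u : E, (inner ℂ u (B z)).re + (inner ℂ z (B u)).re = 0 := by
    intro u
    set c := (inner ℂ u (B z)).re + (inner ℂ z (B u)).re with hc
    set d := (inner ℂ u (B u)).re with hd
    have hd0 : 0 ≤ d := hB u
    have hq : ∀ t : ℝ, 0 ≤ c * t + d * t ^ 2 := by
      intro t
      have h := hB (z + (t : ℂ) • u)
      simp only [map_add, map_smul, inner_add_left, inner_add_right, inner_smul_left,
        inner_smul_right, Complex.conj_ofReal, Complex.add_re, Complex.re_ofReal_mul, hz] at h
      linarith
    -- Dividing by `d + 1` rather than `d` also covers `d = 0`.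
    have h := hq (-c / (d + 1))
    have h1 : c * (-c / (d + 1)) + d * (-c / (d + 1)) ^ 2 = -(c / (d + 1)) ^ 2 := by
      field_simp
      ring
    have h2 : c / (d + 1) = 0 := by nlinarith
    exact (div_eq_zero_iff.mp h2).resolve_right (by positivity)
  have h1 := key u
  have h2 := key (Complex.I • u)
  rw [← inner_conj_symm (𝕜 := ℂ) (B u) z]
  simp only [map_smul, inner_smul_left, inner_smul_right] at h2
  apply Complex.ext <;> simp [-inner_conj_symm] at h1 h2 ⊢ <;> linarith

/-- The Gram data of `x`, `S x` for an accretive `S` of numerical radius at most `1 / √2` and a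
unit vector `x` with `‖S x‖ = 1`. -/
theorem inner_eq_of_accretive {E : Type*} [NormedAddCommGroup E] [InnerProductSpace ℂ E]
    (S : E →L[ℂ] E) (hS : ∀ v, 0 ≤ (inner ℂ v (S v)).re)
    (hw : ∀ v, 2 * Complex.normSq (inner ℂ v (S v)) ≤ (inner ℂ v v).re ^ 2)
    {x y : E} (hxy : S x = y) (hx : ‖x‖ = 1) (hy : ‖y‖ = 1) :
    inner ℂ x y = 1 / 2 ∧ inner ℂ x (S y) = 0 ∧ inner ℂ y (S y) = 1 / 2 := by
  have hxx : inner ℂ x x = 1 := by simp [inner_self_eq_norm_sq_to_K, hx]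
  have hyy : inner ℂ y y = 1 := by simp [inner_self_eq_norm_sq_to_K, hy]
  have hyx : inner ℂ y x = conj (inner ℂ x y) := (inner_conj_symm (𝕜 := ℂ) y x).symm
  have hnn : ∀ v : E, 0 ≤ (inner ℂ v v).re := fun v => inner_self_nonneg (𝕜 := ℂ)
  have htri : ∀ v, (inner ℂ v (S v)).re + |(inner ℂ v (S v)).im| ≤ (inner ℂ v v).re := by
    intro v
    have h := hw v
    rw [Complex.normSq_apply] at h
    refine abs_le_of_sq_le_sq' ?_ (hnn v) |>.2
    nlinarith [sq_nonneg ((inner ℂ v (S v)).re - |(inner ℂ v (S v)).im|),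
      abs_mul_abs_self (inner ℂ v (S v)).im]
  -- The real parts of `B` and `C` encode the two slanted sides, `Re - Im ≤ 1` and `Re + Im ≤ 1`.
  set B : E →L[ℂ] E := .id ℂ E - (1 + Complex.I) • S with hBdef
  set C : E →L[ℂ] E := .id ℂ E - (1 - Complex.I) • S with hCdef
  have hB : ∀ v, 0 ≤ (inner ℂ v (B v)).re := by
    intro v
    have h := htri v
    have h' := neg_abs_le (inner ℂ v (S v)).im
    simp [hBdef, -inner_self_eq_norm_sq_to_K]
    linarith
  have hC : ∀ v, 0 ≤ (inner ℂ v (C v)).re := by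
    intro v
    have h := htri v
    have h' := le_abs_self (inner ℂ v (S v)).im
    simp [hCdef, -inner_self_eq_norm_sq_to_K]
    linarith
  have n1 := hS (y - x)
  have n2 := hB (y - Complex.I • x)
  have n3 := hC (y + Complex.I • x)
  -- All terms in `S y` cancel, and `‖x‖ = ‖y‖ = 1` removes the rest; three nonnegative numbers with
  -- sum zero all vanish.
  have hsum : (inner ℂ (y - x) (S (y - x))).re
      + 1 / 2 * (inner ℂ (y - Complex.I • x) (B (y - Complex.I • x))).re
      + 1 / 2 * (inner ℂ (y + Complex.I • x) (C (y + Complex.I • x))).re = 0 := by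
    simp only [hBdef, hCdef, inner_sub_right, inner_sub_left, inner_add_left, inner_add_right,
      inner_smul_left, inner_smul_right, hxy, hxx, hyy, hyx, map_sub, map_add, map_smul,
      sub_apply, smul_apply, ContinuousLinearMap.id_apply]
    simp [-inner_conj_symm]
    ring
  have e1 := inner_add_inner_eq_zero_of_re_inner_eq_zero S hS (z := y - x) (by linarith)
  have e2 := inner_add_inner_eq_zero_of_re_inner_eq_zero B hB (z := y - Complex.I • x)
    (by linarith)
  have e3 := inner_add_inner_eq_zero_of_re_inner_eq_zero C hC (z := y + Complex.I • x)
    (by linarith)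
  have f1 := e1 x
  have f2 := e1 y
  have f3 := e2 y
  have f4 := e3 y
  have w1 := hw (x + Complex.I • y)
  have w2 := hw (x - Complex.I • y)
  have hSyx := inner_conj_symm (𝕜 := ℂ) (S y) x
  have hSyy := inner_conj_symm (𝕜 := ℂ) (S y) y
  simp only [hBdef, hCdef, inner_sub_right, inner_sub_left, inner_add_left, inner_add_right,
      inner_smul_left, inner_smul_right, hxy, hxx, hyy, hyx, map_sub, map_add, map_smul,
      sub_apply, smul_apply, ContinuousLinearMap.id_apply,
      ← hSyx, ← hSyy] at f1 f2 f3 f4 w1 w2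
  generalize inner ℂ x y = g at *
  generalize inner ℂ x (S y) = h at *
  generalize inner ℂ y (S y) = k at *
  obtain ⟨a, b⟩ := g
  obtain ⟨c, d⟩ := h
  obtain ⟨p, q⟩ := k
  simp [Complex.ext_iff, Complex.normSq_apply] at f1 f2 f3 f4 w1 w2 ⊢
  obtain ⟨f1, f1'⟩ := f1
  obtain ⟨f2, f2'⟩ := f2
  obtain ⟨f3, f3'⟩ := f3
  obtain ⟨f4, f4'⟩ := f4
  have hd : d = 0 := by linarith
  have hc : c = 2 * a - 1 := by linarith
  have hp : p = a := by linarith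
  have hq : q = b := by linarith
  subst hd hc hp hq
  -- The sum of the radius bounds at `x + i y` and `x - i y`.
  have hs : (2 * p - 1) ^ 2 + q ^ 2 ≤ 0 := by nlinarith
  have hp : 2 * p - 1 = 0 := by nlinarith
  have hq : q = 0 := by nlinarith
  refine ⟨⟨?_, ?_⟩, ⟨?_, ?_⟩, ?_, ?_⟩ <;> linarith

theorem norm_inner_le_numericalRadius_mul {E : Type*} [NormedAddCommGroup E]
    [InnerProductSpace ℂ E] (S : E →L[ℂ] E) (v : E) :
    ‖inner ℂ v (S v)‖ ≤ numericalRadius S * ‖v‖ ^ 2 := by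
  rcases eq_or_ne v 0 with rfl | hv
  · simp
  have hv' : ‖v‖ ≠ 0 := norm_ne_zero_iff.mpr hv
  set c : ℂ := (‖v‖ : ℂ)⁻¹ with hc
  have hcn : ‖c‖ = ‖v‖⁻¹ := by simp [hc]
  have hu : ‖c • v‖ = 1 := by rw [norm_smul, hcn, inv_mul_cancel₀ hv']
  have h : ‖inner ℂ (c • v) (S (c • v))‖ ≤ numericalRadius S :=
    le_csSup (bddAbove_norm_numericalRange S) ⟨_, ⟨c • v, hu, rfl⟩, rfl⟩
  rw [map_smul, inner_smul_left, inner_smul_right, norm_mul, norm_mul, RCLike.norm_conj, hcn] at h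
  calc ‖inner ℂ v (S v)‖ = ‖v‖⁻¹ * (‖v‖⁻¹ * ‖inner ℂ v (S v)‖) * ‖v‖ ^ 2 := by field_simp
    _ ≤ _ := by gcongr

theorem numericalRadius_smul {E : Type*} [NormedAddCommGroup E] [InnerProductSpace ℂ E]
    (c : ℂ) (S : E →L[ℂ] E) : numericalRadius (c • S) = ‖c‖ * numericalRadius S := by
  have h : (fun μ : ℂ => ‖μ‖) '' numericalRange (c • S)
      = (fun r : ℝ => ‖c‖ • r) '' ((fun μ : ℂ => ‖μ‖) '' numericalRange S) := by
    ext r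
    simp [numericalRange]
  rw [numericalRadius, h, Set.image_smul, Real.sSup_smul_of_nonneg (norm_nonneg c), smul_eq_mul,
    numericalRadius]

theorem numericalRadius_normalizedOperator {E : Type*} [NormedAddCommGroup E]
    [InnerProductSpace ℂ E] (T : E →L[ℂ] E) :
    numericalRadius (normalizedOperator T) = numericalRadius T / ‖T‖ := by
  rw [normalizedOperator, numericalRadius_smul, div_eq_inv_mul]
  simp

theorem inner_compression {E : Type*} [NormedAddCommGroup E] [InnerProductSpace ℂ E]
    (S : E →L[ℂ] E) (V : Submodule ℂ E) [V.HasOrthogonalProjection] (u v : V) :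
    inner ℂ u (compression S V v) = inner ℂ (u : E) (S v) := by
  simp [compression]

theorem ofReal_sqrt_three_mul_self : ((√3 : ℝ) : ℂ) * ((√3 : ℝ) : ℂ) = 3 := by
  rw [← Complex.ofReal_mul, Real.mul_self_sqrt (by norm_num)]
  norm_num

theorem inv_sqrt_two_le_numericalRadius_of_compression {E : Type*} [NormedAddCommGroup E]
    [InnerProductSpace ℂ E] (S : E →L[ℂ] E) (V : Submodule ℂ E) [V.HasOrthogonalProjection]
    (h : UnitarilySimilarToMatrix (compression S V) extremalMatrix) :
    1 / √2 ≤ numericalRadius S := by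
  obtain ⟨U, hU⟩ := h
  -- A unit vector at which the matrix takes the value `(1 + i) / 2`.
  set p : EuclideanSpace ℂ (Fin 2) := !₂[((√3 : ℝ) : ℂ) / 2, Complex.I / 2] with hp
  have hs := ofReal_sqrt_three_mul_self
  have hs0 : ((√3 : ℝ) : ℂ) ≠ 0 := by
    intro h0
    rw [h0] at hs
    norm_num at hs
  have hpn : ‖U.symm p‖ ^ 2 = 1 := by
    rw [U.symm.norm_map, EuclideanSpace.norm_sq_eq]
    simp [hp, Fin.sum_univ_two, div_pow]
    norm_num
  have hval : inner ℂ ((U.symm p : V) : E) (S (U.symm p : V)) = (1 + Complex.I) / 2 := by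
    rw [← inner_compression, ← U.inner_map_map, hU, U.apply_symm_apply]
    simp [hp, extremalMatrix, PiLp.inner_apply, Fin.sum_univ_two,
      Matrix.toEuclideanCLM_toLp, Complex.conj_ofNat]
    field_simp
    linear_combination 2 * hs
  have hle := norm_inner_le_numericalRadius_mul S (U.symm p : V)
  rw [hval, ← Submodule.coe_norm, hpn, mul_one] at hle
  refine le_trans (le_of_eq ?_) hle
  rw [norm_div, Complex.norm_def, Complex.normSq_apply]
  norm_num
  rw [inv_eq_one_div, div_eq_div_iff (by positivity) (by positivity)]
  simp

theorem unitarilySimilar_extremalMatrix_of_inner {E : Type*} [NormedAddCommGroup E]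
    [InnerProductSpace ℂ E] (S : E →L[ℂ] E) (x y : E) (V : Submodule ℂ E)
    [V.HasOrthogonalProjection] (hV : V = Submodule.span ℂ {x, y}) (hxy : S x = y)
    (hx : ‖x‖ = 1) (hy : ‖y‖ = 1) (h₁ : inner ℂ x y = 1 / 2) (h₂ : inner ℂ x (S y) = 0)
    (h₃ : inner ℂ y (S y) = 1 / 2) :
    UnitarilySimilarToMatrix (compression S V) extremalMatrix := by
  have hxx : inner ℂ x x = 1 := by simp [inner_self_eq_norm_sq_to_K, hx]
  have hyy : inner ℂ y y = 1 := by simp [inner_self_eq_norm_sq_to_K, hy]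
  have hyx : inner ℂ y x = 1 / 2 := by rw [← inner_conj_symm, h₁]; simp [Complex.conj_ofNat]
  have hs := ofReal_sqrt_three_mul_self
  have hsc : conj ((√3 : ℝ) : ℂ) = ((√3 : ℝ) : ℂ) := Complex.conj_ofReal _
  generalize hsdef : ((√3 : ℝ) : ℂ) = s at hs hsc
  have hs0 : s ≠ 0 := by rintro rfl; norm_num at hs
  have hxV : x ∈ V := hV ▸ Submodule.subset_span (by simp)
  have hyV : y ∈ V := hV ▸ Submodule.subset_span (by simp)
  have hcomb : ∀ v : V, ∃ a b : ℂ, a • x + b • y = (v : E) := fun v =>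
    Submodule.mem_span_pair.mp (hV ▸ v.2)
  -- As `⟨x, y⟩ = 1 / 2`, the vectors `x + y` and `x - y` are orthogonal, of norms `√3` and `1`.
  set e : Fin 2 → V :=
    ![⟨s⁻¹ • (x + y), V.smul_mem _ (V.add_mem hxV hyV)⟩, ⟨x - y, V.sub_mem hxV hyV⟩] with he
  have he0 : ((e 0 : V) : E) = s⁻¹ • (x + y) := rfl
  have he1 : ((e 1 : V) : E) = x - y := rfl
  have hon : Orthonormal ℂ e := by
    rw [orthonormal_iff_ite]
    intro i j
    fin_cases i <;> fin_cases j <;>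
      simp only [Fin.zero_eta, Fin.mk_one, Submodule.coe_inner, he0, he1, inner_smul_left,
        inner_smul_right, inner_add_left, inner_add_right, inner_sub_left, inner_sub_right,
        hxx, hyy, hyx, h₁, map_inv₀, hsc] <;> norm_num
    field_simp
    linear_combination -2 * hs
  have hsp : ⊤ ≤ Submodule.span ℂ (Set.range e) := by
    rintro v -
    obtain ⟨a, b, hab⟩ := hcomb v
    have hv : v = ((a + b) * s / 2) • e 0 + ((a - b) / 2) • e 1 := by
      apply Subtype.ext
      rw [Submodule.coe_add, Submodule.coe_smul, Submodule.coe_smul, he0, he1, ← hab, smul_smul,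
        show (a + b) * s / 2 * s⁻¹ = (a + b) / 2 by field_simp]
      module
    rw [hv]
    exact Submodule.add_mem _
      (Submodule.smul_mem _ _ (Submodule.subset_span (Set.mem_range_self 0)))
      (Submodule.smul_mem _ _ (Submodule.subset_span (Set.mem_range_self 1)))
  refine ⟨(OrthonormalBasis.mk hon hsp).repr, fun v => ?_⟩
  obtain ⟨a, b, hab⟩ := hcomb v
  ext i
  rw [Matrix.ofLp_toEuclideanCLM]
  simp only [Matrix.mulVec, dotProduct, Fin.sum_univ_two, OrthonormalBasis.repr_apply_apply,
    OrthonormalBasis.coe_mk, inner_compression]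
  fin_cases i <;>
    simp only [Fin.zero_eta, Fin.mk_one, Submodule.coe_inner, ← hab, he0, he1, inner_smul_left,
      inner_smul_right, inner_add_left, inner_add_right, inner_sub_left,
      hxx, hyy, hyx, h₁, h₂, h₃, map_inv₀, hsc, map_add, map_smul, hxy, extremalMatrix, hsdef] <;>
    simp <;> field_simp
  · ring
  · linear_combination (-a - b) * hs

theorem theorem3p8 {H : Type*} [NormedAddCommGroup H] [InnerProductSpace ℂ H] [CompleteSpace H]
    (hdim : 3 ≤ Module.rank ℂ H)
    (T : H →L[ℂ] H) (hT0 : T ≠ 0)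
    (hT : (T + ContinuousLinearMap.adjoint T).IsPositive)
    (x : H) (hx : ‖x‖ = 1) (hTx : ‖T x‖ = ‖T‖) :
    ‖T‖ / numericalRadius T = √2 ↔
      UnitarilySimilarToMatrix
          (compression (normalizedOperator T) (Submodule.span ℂ ({x, T x} : Set H)))
          extremalMatrix ∧
        numericalRadius (normalizedOperator T) ≤ 1 / √2 := by
  have hn : 0 < ‖T‖ := norm_pos_iff.mpr hT0
  have hnc : (‖T‖ : ℂ) ≠ 0 := by exact_mod_cast hn.ne'
  have h2 : (0 : ℝ) < √2 := by positivity
  have hiff : ‖T‖ / numericalRadius T = √2 ↔ numericalRadius (normalizedOperator T) = 1 / √2 := by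
    rw [numericalRadius_normalizedOperator, ← inv_inj, inv_div, one_div]
  rw [hiff]
  constructor
  · intro hw
    refine ⟨?_, hw.le⟩
    set S := normalizedOperator T with hSdef
    have hSapp : ∀ v, S v = (‖T‖ : ℂ)⁻¹ • T v := fun v => rfl
    have hSx : ‖S x‖ = 1 := by
      rw [hSapp, norm_smul, hTx]
      simp [hn.ne']
    have hacc : ∀ v, 0 ≤ (inner ℂ v (S v)).re := by
      intro v
      have h := hT.re_inner_nonneg_right v
      rw [add_apply, inner_add_right, ContinuousLinearMap.adjoint_inner_right,
        ← inner_conj_symm (T v) v] at h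
      have h' : 0 ≤ (inner ℂ v (T v)).re := by
        simp [-inner_conj_symm] at h
        linarith
      rw [hSapp, inner_smul_right, ← Complex.ofReal_inv, Complex.re_ofReal_mul]
      positivity
    have hrad : ∀ v, 2 * Complex.normSq (inner ℂ v (S v)) ≤ (inner ℂ v v).re ^ 2 := by
      intro v
      have h := norm_inner_le_numericalRadius_mul S v
      rw [hw] at h
      have h' := pow_le_pow_left₀ (norm_nonneg _) h 2
      have hvv : (inner ℂ v v).re = ‖v‖ ^ 2 := inner_self_eq_norm_sq (𝕜 := ℂ) v
      rw [mul_pow, div_pow, Real.sq_sqrt (by norm_num)] at h'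
      rw [Complex.normSq_eq_norm_sq, hvv]
      linarith
    obtain ⟨h₁, h₂, h₃⟩ := inner_eq_of_accretive S hacc hrad rfl hx hSx
    refine unitarilySimilar_extremalMatrix_of_inner S x (S x) _ ?_ rfl hx hSx h₁ h₂ h₃
    rw [hSapp, Submodule.span_insert, Submodule.span_insert,
      Submodule.span_singleton_smul_eq (inv_ne_zero hnc).isUnit]
  · rintro ⟨hU, hw⟩
    exact le_antisymm hw (inv_sqrt_two_le_numericalRadius_of_compression _ _ hU)
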